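/- Let $0<d<n$ be integers and let $M$ be a closed affine $n$-manifold, that is, a compact connected Hausdorff manifold without boundary with an atlas of charts to $\mathbb{R}^n$ whose transition maps are locally restrictions of affine maps. Let $p:\tilde M\to M$ be the universal covering and let $(\mathrm{dev},h)$ be a development pair: $\mathrm{dev}:\tilde M\to\mathbb{R}^n$ is an affine immersion and $h:\pi_1(M)\to\mathrm{Aff}(\mathbb{R}^n)$ is a homomorphism from the group of deck transformations such that $\mathrm{dev}\circ\vartheta=h(\vartheta)\circ\mathrm{dev}$ for every deck transformation $\vartheta$. If the holonomy group $h(\pi_1(M))$ has shrinkable dimension $\le d$, then $M$ is $d$-convex. Here the terms have the following meaning. Shrinkable dimension. For a Euclidean norm $\|v\|'=\|f(v)\|$ on $\mathbb{R}^n$, where $f$ is a linear automorphism and $\|\cdot\|$ is the standard norm, an $i$-ball of radius $\varepsilon$ is the set $\{v\in V:\|v\|'\le\varepsilon\}$ for an $i$-dimensional linear subspace $V$. A subgroup $\Gamma$ of $\mathrm{GL}(n,\mathbb{R})$ has shrinkable dimension $\le d$ if, for some such norm, for every $\varepsilon>0$ there is $\eta>0$ such that for every $\vartheta\in\Gamma$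 there is an $(n-d)$-ball $E$ of radius $\varepsilon$ with $\|w\|'\ge\eta$ for every $w$ in the boundary of $\vartheta(E)$. (The condition depends neither on the norm nor on $\varepsilon$.) A subgroup of $\mathrm{Aff}(\mathbb{R}^n)$ has shrinkable dimension $\le d$ if the group of its linear parts does. $d$-convexity. Give $\tilde M$ the distance induced by the Riemannian metric that $\mathrm{dev}$ pulls back from the Euclidean metric of $\mathbb{R}^n$; let $\check M$ be the Cauchy completion of $\tilde M$, let $\mathrm{dev}:\check M\to\mathbb{R}^n$ also denote the continuous extension of $\mathrm{dev}$, and let $\tilde M_\infty=\check M\setminus\tilde M$ be the ideal set. An $m$-simplex in $\check M$ is a subset $T\subset\check M$ such that $\mathrm{dev}|T$ is a topological embedding onto a closed nondegenerate affine $m$-simplex in $\mathbb{R}^n$ and such that the interior $T^o$ of $T$ (the points of $T$ mapped by $\mathrm{dev}$ into the interior of that affine simplex) is contained in $\tilde M$; its sides are the subsets of $T$ mapped onto the sides (codimension-one faces) of that affine simplex. $M$ is $d$-convex if, whenever $T\subset\check M$ is a $(d+1)$-simplex with sides $F_1,\dots,F_{d+2}$, in any order, such that $T^o\cup F_2\cup\cdots\cup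 F_{d+2}$ does not meet $\tilde M_\infty$, then $T$ does not meet $\tilde M_\infty$, that is, $T\subset\tilde M$. -/

import Mathlib

open Set Filter Topology

/-- The model space `ℝⁿ` with its standard Euclidean metric. -/
abbrev AffModel (n : ℕ) : Type := EuclideanSpace ℝ (Fin n)

/-- The pregroupoid of maps which are, near every point of their domain, restrictions of
affine maps of `ℝⁿ`. -/
def affinePregroupoid (n : ℕ) : Pregroupoid (AffModel n) where
  property f s := ∀ x ∈ s, ∃ A : AffModel n →ᵃ[ℝ] AffModel n, f =ᶠ[𝓝[s] x] A
  comp := by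
    intro f g u v hf hg hu hv huv x hx
    obtain ⟨A, hA⟩ := hf x hx.1
    obtain ⟨B, hB⟩ := hg (f x) hx.2
    refine ⟨B.comp A, ?_⟩
    rw [hu.nhdsWithin_eq hx.1] at hA
    rw [hv.nhdsWithin_eq hx.2] at hB
    rw [huv.nhdsWithin_eq hx]
    have hfc : ContinuousAt f x :=
      (A.continuous_of_finiteDimensional.continuousAt).congr hA.symm
    filter_upwards [hA, hfc.eventually hB] with y hy hy'
    simp only [Function.comp_apply, AffineMap.coe_comp]
    rw [hy', hy]
  id_mem := fun x _ => ⟨AffineMap.id ℝ _, Eventually.of_forall fun _ => rfl⟩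
  locality := by
    intro f u _ h x hx
    obtain ⟨v, hv, hxv, hf⟩ := h x hx
    obtain ⟨A, hA⟩ := hf x ⟨hx, hxv⟩
    refine ⟨A, ?_⟩
    rwa [nhdsWithin_inter_of_mem' (mem_nhdsWithin_of_mem_nhds (hv.mem_nhds hxv))] at hA
  congr := by
    intro f g u _ h hf x hx
    obtain ⟨A, hA⟩ := hf x hx
    refine ⟨A, ?_⟩
    filter_upwards [hA, self_mem_nhdsWithin] with y hy hyu
    rw [h y hyu, hy]

/-- The structure groupoid of locally affine homeomorphisms between open subsets of `ℝⁿ`.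
An affine `n`-manifold (without boundary) is a charted space `M` over `ℝⁿ` with
`HasGroupoid M (affineGroupoid n)`. -/
def affineGroupoid (n : ℕ) : StructureGroupoid (AffModel n) :=
  (affinePregroupoid n).groupoid

/-- The group of deck transformations of `p : X → M`. -/
def deckGroup {M X : Type*} [TopologicalSpace X] (p : X → M) : Subgroup (X ≃ₜ X) where
  carrier := {θ | ∀ x, p (θ x) = p x}
  mul_mem' := fun {a b} ha hb x => (ha (b x)).trans (hb x)
  one_mem' := fun _ => rfl
  inv_mem' := fun {a} ha x => by
    have h := ha (a.symm x)
    rw [a.apply_symm_apply] at h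
    exact h.symm

/-- A development pair `(dev, hol)` of the affine manifold `M`, for the universal covering
`p : X → M`: the developing map `dev : X → ℝⁿ` is an affine immersion (near every point it is
an affine chart of `X`, i.e. a chart of `M` composed with `p` and an affine automorphism
of `ℝⁿ`), equivariant with respect to the holonomy homomorphism `hol` from the deck group to
the group of affine automorphisms of `ℝⁿ`. -/
structure DevelopmentPair (n : ℕ) {M X : Type*} [TopologicalSpace M]
    [ChartedSpace (AffModel n) M] [TopologicalSpace X] (p : X → M) where
  /-- the developing map -/
  dev : X → AffModel n
  /-- the holonomy homomorphism -/
  hol : deckGroup p →* (AffModel n ≃ᵃ[ℝ] AffModel n)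
  locally_affine : ∀ x : X, ∃ A : AffModel n ≃ᵃ[ℝ] AffModel n,
    dev =ᶠ[𝓝 x] fun y => A (chartAt (AffModel n) (p x) (p y))
  equivariant : ∀ (θ : deckGroup p) (x : X), dev (θ.1 x) = hol θ (dev x)

/-- A group `Γ` of linear automorphisms of `ℝⁿ` has shrinkable dimension `≤ d`, for
`0 ≤ d ≤ n - 1`. Here `f` gives the Euclidean norm `v ↦ ‖f v‖` of a pulled back Euclidean
metric; for a subspace `V` of dimension `n - d`, the `(n - d)`-ball of radius `ε` in `V` has
boundary sphere `{v ∈ V | ‖f v‖ = ε}`, and `θ` maps that sphere onto the boundary of the image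
of the ball. The condition depends neither on `f` nor on `ε`. -/
def ShrinkableDimLE {n : ℕ} (Γ : Subgroup (AffModel n ≃ₗ[ℝ] AffModel n)) (d : ℕ) : Prop :=
  ∃ f : AffModel n ≃ₗ[ℝ] AffModel n, ∀ ε : ℝ, 0 < ε → ∃ η : ℝ, 0 < η ∧
    ∀ θ ∈ Γ, ∃ V : Submodule ℝ (AffModel n), Module.finrank ℝ V + d = n ∧
      ∀ v ∈ V, ‖f v‖ = ε → η ≤ ‖f (θ v)‖

/-- A group of affine automorphisms has shrinkable dimension `≤ d` if its group of linear
parts does. -/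
def AffineShrinkableDimLE {n : ℕ} (G : Subgroup (AffModel n ≃ᵃ[ℝ] AffModel n)) (d : ℕ) : Prop :=
  ShrinkableDimLE (G.map AffineEquiv.linearHom) d

namespace DevelopmentPair

variable {n : ℕ} {M X : Type*} [TopologicalSpace M] [ChartedSpace (AffModel n) M]
  [TopologicalSpace X] {p : X → M}

/-- The holonomy group. -/
noncomputable def holonomyGroup (D : DevelopmentPair n p) : Subgroup (AffModel n ≃ᵃ[ℝ] AffModel n) :=
  D.hol.range

/-- The length of a path for the Riemannian metric which `dev` pulls back from `ℝⁿ`, that is,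
the Euclidean length of its developed image. -/
noncomputable def pathLength (D : DevelopmentPair n p) {x y : X} (γ : Path x y) : ENNReal :=
  eVariationOn (D.dev ∘ γ) univ

theorem pathLength_refl (D : DevelopmentPair n p) (x : X) : D.pathLength (Path.refl x) = 0 := by
  apply eVariationOn.constant_on
  rintro _ ⟨s, -, rfl⟩ _ ⟨t, -, rfl⟩
  simp

theorem edist_dev_le_pathLength (D : DevelopmentPair n p) {x y : X} (γ : Path x y) :
    edist (D.dev x) (D.dev y) ≤ D.pathLength γ := by
  have h := eVariationOn.edist_le (D.dev ∘ γ) (s := univ) (mem_univ 0) (mem_univ 1)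
  simpa [pathLength] using h

theorem pathLength_symm_le (D : DevelopmentPair n p) {x y : X} (γ : Path x y) :
    D.pathLength γ.symm ≤ D.pathLength γ := by
  have h := eVariationOn.comp_le_of_antitoneOn (D.dev ∘ γ) (s := univ) (t := univ)
    (unitInterval.symm) (fun a _ b _ hab => unitInterval.symm_le_symm.2 hab) (fun _ _ => mem_univ _)
  exact h

theorem pathLength_eq_extend (D : DevelopmentPair n p) {x y : X} (γ : Path x y) :
    D.pathLength γ = eVariationOn (D.dev ∘ γ.extend) (Icc 0 1) := by
  apply le_antisymm
  · have h := eVariationOn.comp_le_of_monotoneOn (D.dev ∘ γ.extend) (s := Icc (0 : ℝ) 1)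
      (t := (univ : Set unitInterval)) (fun t => (t : ℝ)) (fun a _ b _ hab => hab)
      (fun t _ => t.2)
    refine le_of_eq_of_le ?_ h
    refine eVariationOn.congr fun t _ => ?_
    simp
  · have h := eVariationOn.comp_le_of_monotoneOn (D.dev ∘ γ) (s := univ)
      (t := Icc (0 : ℝ) 1) (projIcc 0 1 zero_le_one)
      ((monotone_projIcc zero_le_one).monotoneOn _) (fun t _ => mem_univ _)
    exact h

theorem pathLength_trans_le (D : DevelopmentPair n p) {x y z : X} (γ : Path x y)
    (γ' : Path y z) : D.pathLength (γ.trans γ') ≤ D.pathLength γ + D.pathLength γ' := by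
  rw [pathLength_eq_extend, pathLength_eq_extend, pathLength_eq_extend]
  have hsum := eVariationOn.Icc_add_Icc (D.dev ∘ (γ.trans γ').extend) (s := univ)
    (a := (0 : ℝ)) (b := 1 / 2) (c := 1) (by norm_num) (by norm_num) (mem_univ _)
  simp only [univ_inter] at hsum
  rw [← hsum]
  gcongr
  · have h := eVariationOn.comp_le_of_monotoneOn (D.dev ∘ γ.extend) (s := Icc (0 : ℝ) 1)
      (t := Icc (0 : ℝ) (1 / 2)) (fun t => 2 * t)
      (fun a _ b _ hab => by dsimp only; linarith)
      (fun t ht => ⟨by linarith [ht.1], by linarith [ht.2]⟩)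
    refine le_of_eq_of_le ?_ h
    refine eVariationOn.congr fun t ht => ?_
    have ht1 : t ∈ Icc (0 : ℝ) 1 := ⟨ht.1, by linarith [ht.2]⟩
    simp only [Function.comp_apply]
    rw [Path.extend_apply _ ht1, Path.trans_apply, dif_pos ht.2,
      Path.extend_apply _ (⟨by linarith [ht.1], by linarith [ht.2]⟩ : 2 * t ∈ Icc (0 : ℝ) 1)]
  · have h := eVariationOn.comp_le_of_monotoneOn (D.dev ∘ γ'.extend) (s := Icc (0 : ℝ) 1)
      (t := Icc (1 / 2 : ℝ) 1) (fun t => 2 * t - 1)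
      (fun a _ b _ hab => by dsimp only; linarith)
      (fun t ht => ⟨by linarith [ht.1], by linarith [ht.2]⟩)
    refine le_of_eq_of_le ?_ h
    refine eVariationOn.congr fun t ht => ?_
    have ht1 : t ∈ Icc (0 : ℝ) 1 := ⟨by linarith [ht.1], ht.2⟩
    have ht2 : 2 * t - 1 ∈ Icc (0 : ℝ) 1 := ⟨by linarith [ht.1], by linarith [ht.2]⟩
    simp only [Function.comp_apply]
    rw [Path.extend_apply _ ht1, Path.trans_apply, Path.extend_apply _ ht2]
    split_ifs with hle
    · have hte : t = 1 / 2 := le_antisymm hle ht.1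
      subst hte
      simp
    · rfl

/-- The universal covering space `X`, endowed with the distance induced by the Riemannian
metric which `dev` pulls back from `ℝⁿ`. -/
def Cover (_D : DevelopmentPair n p) : Type _ := X

/-- The distance of two points is the infimum of the lengths of the paths of `X` joining
them. -/
noncomputable instance (D : DevelopmentPair n p) : PseudoEMetricSpace D.Cover where
  edist x y := ⨅ γ : Path (X := X) x y, D.pathLength γ
  edist_self x := le_antisymm
    ((iInf_le _ (Path.refl (X := X) x)).trans_eq (D.pathLength_refl x)) (zero_le)
  edist_comm x y := le_antisymm
    (le_iInf fun γ => (iInf_le _ γ.symm).trans (D.pathLength_symm_le γ))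
    (le_iInf fun γ => (iInf_le _ γ.symm).trans (D.pathLength_symm_le γ))
  edist_triangle x y z := by
    rw [ENNReal.iInf_add]
    refine le_iInf fun γ => ?_
    rw [ENNReal.add_iInf]
    exact le_iInf fun γ' => (iInf_le _ (γ.trans γ')).trans (D.pathLength_trans_le γ γ')

/-- The developing map on `X` with its induced distance. -/
def coverDev (D : DevelopmentPair n p) : D.Cover → AffModel n := D.dev

/-- The developing map does not increase distances; so it extends to the completion. -/
theorem lipschitzWith_coverDev (D : DevelopmentPair n p) : LipschitzWith 1 D.coverDev := by
  intro x y
  rw [ENNReal.coe_one, one_mul]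
  exact le_iInf fun γ => D.edist_dev_le_pathLength γ

/-- The completion of `M`: the Cauchy completion of the universal covering space. -/
abbrev Completion (D : DevelopmentPair n p) : Type _ := UniformSpace.Completion D.Cover

/-- The continuous extension of the developing map to the completion. -/
noncomputable def completionDev (D : DevelopmentPair n p) : D.Completion → AffModel n :=
  UniformSpace.Completion.extension D.coverDev

/-- The ideal set: the points of the completion outside the universal covering space. -/
def idealSet (D : DevelopmentPair n p) : Set D.Completion :=
  (range ((↑) : D.Cover → D.Completion))ᶜ

/-- The part of a subset `T` of the completion lying over a subset `S` of `ℝⁿ`. -/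
def partOver (D : DevelopmentPair n p) (T : Set D.Completion) (S : Set (AffModel n)) :
    Set D.Completion :=
  {a ∈ T | D.completionDev a ∈ S}

/-- `T` is an `m`-simplex in the completion, with developed image the nondegenerate affine
simplex `s`: the restriction of `dev` to `T` is a topological embedding onto `s` (so that `T`
is a compact `m`-ball), and the interior of `T` is contained in the universal covering space. -/
structure IsSimplex (D : DevelopmentPair n p) {m : ℕ} (T : Set D.Completion)
    (s : Affine.Simplex ℝ (AffModel n) m) : Prop where
  isEmbedding : IsEmbedding (T.domRestrict D.completionDev)
  image_eq : D.completionDev '' T = s.closedInterior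
  interior_disjoint : Disjoint (D.partOver T s.interior) D.idealSet

/-- `m`-convexity, for `0 < m < n`: whenever all sides of an `(m + 1)`-simplex `T` in the
completion but one (the `i`-th) and the interior of `T` do not meet the ideal set,
then `T` does not meet the ideal set. -/
def IsConvexOfDim (D : DevelopmentPair n p) (m : ℕ) : Prop :=
  ∀ (T : Set D.Completion) (s : Affine.Simplex ℝ (AffModel n) (m + 1)), D.IsSimplex T s →
    ∀ i : Fin (m + 2),
      (∀ j, j ≠ i → Disjoint (D.partOver T (s.faceOpposite j).closedInterior) D.idealSet) →
      Disjoint T D.idealSet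

end DevelopmentPair

/-! Take affine coordinates on the span of the simplex, with origin at the vertex opposite the
exceptional side, and let `b` be the barycenter. The points whose segment from `b` lifts to `X` form
an open set Ω (`starDomain`), which contains the simplex except perhaps the relative interior of the
exceptional side. It suffices that Ω contains that too: the lifted endpoints are then the points of
`T`, by uniqueness of limits in the completion (`coe_eq_of_lift`).

If a point is missing, enlarge the simplex slightly past the exceptional side, and let `x` be the
missing point farthest from a suitable, very distant center beyond that side
(`cornerSimplex_subset`). Then `x` is visible from `b`, and the missing points lie in a ball with
`x` on its boundary sphere. From any point of `[b, x)` near `x`, one of any two opposite vectors of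
length `ρ` leads away from that ball, through Ω, into a fixed compact part of Ω.

This contradicts shrinkability (`not_eventually_segment_subset`). As `M` is compact, deck
transformations `θ t` bring the lifts of points tending to `x` back near one point `y₀`. A dimension
count gives, among the `d + 1` directions of the simplex, one which the linear holonomy of `θ t`
keeps short. So `θ t` carries the lifted segment in that direction into a compact neighborhood of
`y₀`, although its endpoint came from a fixed compact set. By proper discontinuity `θ t` is
eventually constant along an ultrafilter; the lift of `[b, x)` then accumulates in `X`, and `x`
belongs to Ω. -/

open scoped unitInterval

/-! ### Lifting segments through a local homeomorphism -/

section StarDomain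

variable {X E : Type*} [TopologicalSpace X] [NormedAddCommGroup E] [NormedSpace ℝ E]

/-- The points `z` such that the segment from `f x₀` to `z` lifts through `f` to a path starting
at `x₀`. -/
def starDomain (f : X → E) (x₀ : X) : Set E :=
  {z | ∃ γ : C(I, X), γ 0 = x₀ ∧ ∀ t : I, f (γ t) = AffineMap.lineMap (f x₀) z (t : ℝ)}

open Classical in
/-- The endpoint of the lift of the segment from `f x₀` to `z`. -/
noncomputable def starExp (f : X → E) (x₀ : X) (z : E) : X :=
  if h : z ∈ starDomain f x₀ then h.choose 1 else x₀

variable {f : X → E} {x₀ : X} {z : E}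

theorem starExp_eq [T2Space X] (hf : IsLocalHomeomorph f) {γ : C(I, X)} (h0 : γ 0 = x₀)
    (hγ : ∀ t : I, f (γ t) = AffineMap.lineMap (f x₀) z (t : ℝ)) : starExp f x₀ z = γ 1 := by
  have h : z ∈ starDomain f x₀ := ⟨γ, h0, hγ⟩
  have hs := h.choose_spec
  rw [starExp, dif_pos h]
  refine congrFun ((T2Space.isSeparatedMap f).eq_of_comp_eq hf.isLocallyInjective
    h.choose.continuous γ.continuous ?_ 0 (hs.1.trans h0.symm)) 1
  funext t
  exact (hs.2 t).trans (hγ t).symm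

theorem apply_starExp (h : z ∈ starDomain f x₀) : f (starExp f x₀ z) = z := by
  rw [starExp, dif_pos h, h.choose_spec.2]
  simp

/-- The part of the lift of a segment up to time `s`. -/
theorem lineMap_mem_starDomain_and_starExp_eq [T2Space X] (hf : IsLocalHomeomorph f)
    {γ : C(I, X)} (h0 : γ 0 = x₀)
    (hγ : ∀ t : I, f (γ t) = AffineMap.lineMap (f x₀) z (t : ℝ)) (s : I) :
    AffineMap.lineMap (f x₀) z (s : ℝ) ∈ starDomain f x₀ ∧
      starExp f x₀ (AffineMap.lineMap (f x₀) z (s : ℝ)) = γ s := by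
  let γ' : C(I, X) := ⟨fun t => γ (s * t), by fun_prop⟩
  have h0' : γ' 0 = x₀ := by simp [γ', h0]
  have hγ' : ∀ t : I, f (γ' t) =
      AffineMap.lineMap (f x₀) (AffineMap.lineMap (f x₀) z (s : ℝ)) (t : ℝ) := by
    intro t
    change f (γ (s * t)) = _
    rw [hγ]
    simp [AffineMap.lineMap_apply, smul_smul, mul_comm]
  refine ⟨⟨γ', h0', hγ'⟩, ?_⟩
  rw [starExp_eq hf h0' hγ']
  simp [γ']

/-- Compactness of `I` keeps the segments to nearby points inside the open set `range f`; a lift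
over one segment then extends to lifts over neighboring ones. -/
theorem isOpen_starDomain (hf : IsLocalHomeomorph f) (x₀ : X) : IsOpen (starDomain f x₀) := by
  classical
  rw [isOpen_iff_mem_nhds]
  rintro z ⟨γ, h0, hγ⟩
  have hline : Continuous fun q : E × I => (AffineMap.lineMap (f x₀) q.1 (q.2 : ℝ) : E) := by
    simp only [AffineMap.lineMap_apply]
    fun_prop
  have hU : ∀ᶠ w in 𝓝 z, ∀ t ∈ (univ : Set I),
      (AffineMap.lineMap (f x₀) w (t : ℝ) : E) ∈ range f := by
    refine isCompact_univ.eventually_forall_of_forall_eventually fun t _ => ?_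
    refine hline.continuousAt.eventually_mem (hf.isOpenMap.isOpen_range.mem_nhds ?_)
    exact ⟨γ t, hγ t⟩
  set N : Set E := {w | ∀ t ∈ (univ : Set I), (AffineMap.lineMap (f x₀) w (t : ℝ) : E) ∈ range f}
  have hzN : z ∈ N := mem_of_mem_nhds hU
  let F : C(I × N, E) := ⟨fun q => AffineMap.lineMap (f x₀) (q.2 : E) (q.1 : ℝ),
    hline.comp ((continuous_subtype_val.comp continuous_snd).prodMk continuous_fst)⟩
  -- Continuity of `g` matters only at time `0` and over the segment to `z`; elsewhere any preimages
  -- will do.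
  let g : I × N → X := fun q =>
    if q.1 = 0 then x₀ else if (q.2 : E) = z then γ q.1 else (q.2.2 q.1 (mem_univ _)).choose
  have hgz : (fun t : I => g (t, ⟨z, hzN⟩)) = γ := by
    funext t
    by_cases ht : t = 0
    · simp [g, ht, h0]
    · simp [g, ht]
  obtain ⟨N', hN', g', hg'c, hg'l, hg'0, -⟩ := hf.exists_lift_nhds (f := F) (g := g) (by
      funext ⟨t, w⟩
      change f (g (t, w)) = AffineMap.lineMap (f x₀) (w : E) (t : ℝ)
      by_cases ht : t = 0
      · simp [g, ht]
      · by_cases hw : (w : E) = z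
        · simp [g, ht, hw, hγ]
        · simp only [g, ht, hw, if_false]
          exact (w.2 t (mem_univ _)).choose_spec)
    (by simpa [g] using continuous_const) ⟨z, hzN⟩ (by rw [hgz]; exact γ.continuous)
  have hmem : (Subtype.val '' N' : Set E) ∈ 𝓝 z := by
    have := image_mem_map (m := Subtype.val) hN'
    rwa [map_nhds_subtype_val, nhdsWithin_eq_nhds.2 hU] at this
  refine mem_of_superset hmem ?_
  rintro _ ⟨w, hw, rfl⟩
  refine ⟨⟨fun t => g' (t, w), hg'c.comp_continuous (by fun_prop) fun t => ⟨mem_univ _, hw⟩⟩,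
    ?_, fun t => congrFun hg'l (t, w)⟩
  change g' (0, w) = x₀
  rw [hg'0]
  simp [g]

theorem continuousOn_starExp [T2Space X] (hf : IsLocalHomeomorph f) (x₀ : X) :
    ContinuousOn (starExp f x₀) (starDomain f x₀) := by
  rw [continuousOn_iff_continuous_domRestrict]
  have hline : Continuous fun q : I × starDomain f x₀ =>
      (AffineMap.lineMap (f x₀) (q.2 : E) (q.1 : ℝ) : E) := by
    simp only [AffineMap.lineMap_apply]
    fun_prop
  have h := hf.continuous_lift (T2Space.isSeparatedMap f) ⟨_, hline⟩
    (g := fun q => q.2.2.choose q.1)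
    (by funext ⟨t, w⟩; exact w.2.choose_spec.2 t)
    (by
      have : (fun w : starDomain f x₀ => w.2.choose 0) = fun _ => x₀ := by
        funext w; exact w.2.choose_spec.1
      simpa only [this] using continuous_const)
    (fun w => w.2.choose.continuous)
  convert! h.comp (Continuous.prodMk_right (1 : I)) using 1
  funext w
  simp only [domRestrict_apply, starExp, dif_pos w.2, Function.comp_apply]

/-- If the lifts of the points of a half-open segment accumulate at some point, the closed segment
lifts. -/
theorem mem_starDomain_of_tendsto [T2Space X] (hf : IsLocalHomeomorph f)
    (hz : ∀ t ∈ Ico (0 : ℝ) 1, AffineMap.lineMap (f x₀) z t ∈ starDomain f x₀)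
    {l : Filter ℝ} [l.NeBot] (hl : l ≤ 𝓝[<] 1) {q : X}
    (hq : Tendsto (fun t : ℝ => starExp f x₀ (AffineMap.lineMap (f x₀) z t)) l (𝓝 q)) :
    z ∈ starDomain f x₀ := by
  classical
  set L : ℝ → E := fun t => AffineMap.lineMap (f x₀) z t with hL
  have hLc : Continuous L := AffineMap.lineMap_continuous
  have hIco : ∀ᶠ t in l, t ∈ Ico (0 : ℝ) 1 :=
    hl (mem_of_superset (Ioo_mem_nhdsLT zero_lt_one) Ioo_subset_Ico_self)
  have hfq : f q = z := by
    have h1 : Tendsto (fun t => f (starExp f x₀ (L t))) l (𝓝 (f q)) :=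
      (hf.continuous.tendsto q).comp hq
    have h2 : Tendsto L l (𝓝 (L 1)) := (hLc.tendsto 1).mono_left (hl.trans nhdsWithin_le_nhds)
    have h3 := h2.congr' (hIco.mono fun t ht => (apply_starExp (hz t ht)).symm)
    simpa [hL] using tendsto_nhds_unique h1 h3
  have hexp : ContinuousOn (fun t => starExp f x₀ (L t)) (Ico 0 1) :=
    (continuousOn_starExp hf x₀).comp hLc.continuousOn hz
  set e := hf.localInverseAt q
  have hzs : L 1 ∈ e.source := by
    have := hf.apply_self_mem_localInverseAt_source (x := q)
    rw [hfq] at this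
    simpa [hL] using this
  obtain ⟨δ, hδ, hball⟩ := Metric.isOpen_iff.1 (e.open_source.preimage hLc) 1 hzs
  have hev : ∀ᶠ t in l, t ∈ Ioo (1 - δ) 1 := hl (Ioo_mem_nhdsLT (by linarith))
  -- From time `t₀` on the segment stays in the domain of the local inverse `e` at `q`. Since the
  -- lift is in the target of `e` at `t₀`, uniqueness makes it equal to `e ∘ L` up to time `1`,
  -- where `e` supplies the endpoint.
  obtain ⟨t₀, ht₀, ht₀', ht₀e⟩ := (hIco.and (hev.and
    (hq.eventually (e.open_target.mem_nhds hf.self_mem_localInverseAt_target)))).exists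
  have hsrc : ∀ t ∈ Icc t₀ 1, L t ∈ e.source := fun t ht => hball (by
    rw [Metric.mem_ball, Real.dist_eq, abs_lt]
    constructor <;> linarith [ht.1, ht.2, ht₀'.1])
  have hfe : ∀ w ∈ e.source, f (e w) = w := fun w hw => hf.apply_localInverseAt_of_mem hw
  have hagree : EqOn (fun t => starExp f x₀ (L t)) (fun t => e (L t)) (Ico t₀ 1) := by
    refine (T2Space.isSeparatedMap f).eqOn_of_comp_eqOn hf.isLocallyInjective
      isPreconnected_Ico (hexp.mono (Ico_subset_Ico_left ht₀.1))
      (e.continuousOn.comp hLc.continuousOn fun t ht => hsrc t ⟨ht.1, ht.2.le⟩) ?_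
      (left_mem_Ico.2 ht₀.2) ?_
    · intro t ht
      simp only [Function.comp_apply]
      rw [hfe _ (hsrc t ⟨ht.1, ht.2.le⟩), apply_starExp (hz t ⟨ht₀.1.trans ht.1, ht.2⟩)]
    · refine hf.injOn_localInverseAt_target ht₀e (e.map_source (hsrc t₀ ⟨le_rfl, ht₀.2.le⟩)) ?_
      rw [apply_starExp (hz t₀ ht₀), hfe _ (hsrc t₀ ⟨le_rfl, ht₀.2.le⟩)]
  let g : ℝ → X := fun t => if t < t₀ then starExp f x₀ (L t) else e (L t)
  have hg1 : EqOn g (fun t => starExp f x₀ (L t)) (Ico 0 1) := by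
    intro t ht
    by_cases h : t < t₀
    · simp [g, h]
    · simp only [g, h, if_false]
      exact (hagree ⟨not_lt.1 h, ht.2⟩).symm
  have hg2 : EqOn g (fun t => e (L t)) (Ioc t₀ 1) := by
    intro t ht
    simp [g, not_lt.2 ht.1.le]
  have hgc : ContinuousOn g (Icc 0 1) := by
    intro t ht
    rcases ht.2.lt_or_eq with h | h
    · have hc := (hexp.congr hg1) t ⟨ht.1, h⟩
      refine hc.mono_of_mem_nhdsWithin ?_
      exact mem_nhdsWithin.2 ⟨Iio 1, isOpen_Iio, h, fun s hs => ⟨hs.2.1, hs.1⟩⟩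
    · have hc : ContinuousOn g (Ioc t₀ 1) :=
        (e.continuousOn.comp hLc.continuousOn fun s hs => hsrc s ⟨hs.1.le, hs.2⟩).congr hg2
      refine (hc t ⟨h ▸ ht₀.2, ht.2⟩).mono_of_mem_nhdsWithin ?_
      exact mem_nhdsWithin.2 ⟨Ioi t₀, isOpen_Ioi, h ▸ ht₀.2, fun s hs => ⟨hs.1, hs.2.2⟩⟩
  refine ⟨⟨fun t => g t, hgc.comp_continuous continuous_subtype_val fun t => t.2⟩, ?_, ?_⟩
  · change g ((0 : I) : ℝ) = x₀
    rw [hg1 (by simp)]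
    have := starExp_eq (f := f) (x₀ := x₀) (z := f x₀) hf (γ := .const I x₀) rfl (by simp)
    simpa [hL] using this
  · intro t
    change f (g t) = L t
    rcases t.2.2.lt_or_eq with h | h
    · rw [hg1 ⟨t.2.1, h⟩]
      exact apply_starExp (hz _ ⟨t.2.1, h⟩)
    · rw [hg2 (by rw [h]; exact ⟨ht₀.2, le_rfl⟩)]
      exact hfe _ (by rw [h]; exact hzs)

end StarDomain

/-! ### Covering maps and deck transformations -/

theorem IsLocalHomeomorph.locallyPathConnectedSpace {X Y : Type*} [TopologicalSpace X]
    [TopologicalSpace Y] [LocallyPathConnectedSpace Y] {f : X → Y} (hf : IsLocalHomeomorph f) :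
    LocallyPathConnectedSpace X := by
  let _ : ChartedSpace Y X :=
    { atlas := range fun x => (hf x).choose
      chartAt := fun x => (hf x).choose
      mem_chart_source := fun x => (hf x).choose_spec.1
      chart_mem_atlas := fun x => mem_range_self x }
  exact ChartedSpace.locallyPathConnectedSpace Y X

section Covering

variable {M X : Type*} [TopologicalSpace M] [TopologicalSpace X] {p : X → M}

theorem IsCoveringMap.t2Space [T2Space M] (hp : IsCoveringMap p) : T2Space X := by
  refine ⟨fun x y hxy => ?_⟩
  by_cases h : p x = p y
  · exact hp.isSeparatedMap x y h hxy
  · obtain ⟨u, v, hu, hv, hx, hy, huv⟩ := t2_separation h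
    exact ⟨p ⁻¹' u, p ⁻¹' v, hu.preimage hp.continuous, hv.preimage hp.continuous, hx, hy,
      huv.preimage p⟩

/-- `IsCoveringMap` allows empty fibers. Over an evenly covered neighborhood all fibers are empty as
soon as one is. -/
theorem IsCoveringMap.isClosed_range (hp : IsCoveringMap p) : IsClosed (range p) := by
  rw [← isOpen_compl_iff, isOpen_iff_mem_nhds]
  intro m hm
  obtain ⟨-, U, hmU, hU, -, H, hH⟩ := hp m
  refine mem_of_superset (hU.mem_nhds hmU) ?_
  rintro _ hxU ⟨x, rfl⟩
  have i := (H ⟨x, hxU⟩).2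
  exact hm ⟨i.1, i.2⟩

theorem IsCoveringMap.surjective_of_preconnectedSpace [PreconnectedSpace M] [Nonempty X]
    (hp : IsCoveringMap p) : Function.Surjective p :=
  range_eq_univ.1 (IsClopen.eq_univ ⟨hp.isClosed_range, hp.isOpenMap.isOpen_range⟩
    (range_nonempty p))

theorem deckGroup_eq_of_apply_eq [PreconnectedSpace X] (hp : IsCoveringMap p)
    {θ θ' : deckGroup p} {x : X} (h : θ.1 x = θ'.1 x) : θ = θ' := by
  refine Subtype.ext (Homeomorph.ext fun y => ?_)
  exact congrFun (hp.eq_of_comp_eq θ.1.continuous θ'.1.continuous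
    (funext fun z => (θ.2 z).trans (θ'.2 z).symm) x h) y

/-- The deck group of a universal covering acts transitively on the fibers. -/
theorem exists_deckGroup_apply_eq [SimplyConnectedSpace X] [LocallyPathConnectedSpace X]
    (hp : IsCoveringMap p) {x y : X} (h : p x = p y) : ∃ θ : deckGroup p, θ.1 x = y := by
  obtain ⟨F, ⟨hF0, hF⟩, -⟩ :=
    hp.existsUnique_continuousMap_lifts ⟨p, hp.continuous⟩ x y h.symm
  obtain ⟨G, ⟨hG0, hG⟩, -⟩ :=
    hp.existsUnique_continuousMap_lifts ⟨p, hp.continuous⟩ y x h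
  have hF' : ∀ z, p (F z) = p z := fun z => congrFun hF z
  have hG' : ∀ z, p (G z) = p z := fun z => congrFun hG z
  have hGF : ⇑G ∘ ⇑F = id := hp.eq_of_comp_eq (G.continuous.comp F.continuous) continuous_id
    (funext fun z => (hG' _).trans (hF' z)) x (by simp [hF0, hG0])
  have hFG : ⇑F ∘ ⇑G = id := hp.eq_of_comp_eq (F.continuous.comp G.continuous) continuous_id
    (funext fun z => (hF' _).trans (hG' z)) y (by simp [hF0, hG0])
  exact ⟨⟨⟨⟨F, G, congrFun hGF, congrFun hFG⟩, F.continuous, G.continuous⟩, hF'⟩, hF0⟩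

/-- Proper discontinuity of the deck group, in terms of convergence along a filter. -/
theorem exists_eventually_eq_of_tendsto_deckGroup [T2Space M] [SimplyConnectedSpace X]
    [LocallyPathConnectedSpace X] (hp : IsCoveringMap p) {T : Type*} {l : Filter T} [l.NeBot]
    {θ : T → deckGroup p} {a : T → X} {a₀ w₀ : X} (ha : Tendsto a l (𝓝 a₀))
    (hw : Tendsto (fun t => (θ t).1 (a t)) l (𝓝 w₀)) : ∃ θ₀, ∀ᶠ t in l, θ t = θ₀ := by
  have hpeq : p a₀ = p w₀ := by
    refine tendsto_nhds_unique ((hp.continuous.tendsto a₀).comp ha) ?_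
    refine ((hp.continuous.tendsto w₀).comp hw).congr fun t => ?_
    exact (θ t).2 _
  obtain ⟨θ₀, hθ₀⟩ := exists_deckGroup_apply_eq hp hpeq
  have hw' : Tendsto (fun t => θ₀.1 (a t)) l (𝓝 w₀) := by
    rw [← hθ₀]
    exact (θ₀.1.continuous.tendsto a₀).comp ha
  -- The points `θ t (a t)` and `θ₀ (a t)` have the same image under `p` and both tend to `w₀`, near
  -- which `p` is injective.
  obtain ⟨U, hU, hinj⟩ := isLocallyInjective_iff_nhds.1 hp.isLocalHomeomorph.isLocallyInjective w₀
  refine ⟨θ₀, ?_⟩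
  filter_upwards [hw.eventually_mem hU, hw'.eventually_mem hU] with t h1 h2
  exact deckGroup_eq_of_apply_eq hp (hinj h1 h2 (((θ t).2 _).trans (θ₀.2 _).symm))

end Covering

/-! ### Shrinkable holonomy and accumulation of lifts -/

namespace DevelopmentPair

variable {n : ℕ} {M X : Type*} [TopologicalSpace M] [ChartedSpace (AffModel n) M]
  [TopologicalSpace X] {p : X → M}

theorem isLocalHomeomorph_dev (hp : IsCoveringMap p) (D : DevelopmentPair n p) :
    IsLocalHomeomorph D.dev := by
  refine IsLocalHomeomorph.mk _ fun x => ?_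
  obtain ⟨A, hA⟩ := D.locally_affine x
  obtain ⟨e, hxe, rfl⟩ := hp.isLocalHomeomorph x
  obtain ⟨U, hU, hUo, hxU⟩ := eventually_nhds_iff.1 hA
  let Ah : AffModel n ≃ₜ AffModel n := A.toContinuousAffineEquiv.toHomeomorph
  let c := (e.trans (chartAt (AffModel n) (e x))).trans Ah.toOpenPartialHomeomorph
  refine ⟨c.restrOpen U hUo, ?_, ?_⟩
  · simp [c, hxe, hxU]
  · intro y hy
    have hyU : y ∈ U := by
      simp at hy
      exact hy.2
    exact hU y hyU

/-- Under a group of affine maps of shrinkable dimension `≤ d`, every linear part has, in each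
given `(d + 1)`-dimensional space of directions, a direction in which vectors of a uniform length
are kept in a given ball. -/
theorem exists_forall_deckGroup_direction {d : ℕ} (D : DevelopmentPair n p)
    (hsd : AffineShrinkableDimLE D.holonomyGroup d)
    {A : Type*} [NormedAddCommGroup A] [NormedSpace ℝ A] [FiniteDimensional ℝ A]
    (hA : Module.finrank ℝ A = d + 1) {ψ : A →ₗ[ℝ] AffModel n} (hψ : Function.Injective ψ)
    {r : ℝ} (hr : 0 < r) :
    ∃ ρ₀ > 0, ∀ ρ > 0, ρ ≤ ρ₀ → ∀ θ : deckGroup p, ∃ u : A, ‖u‖ = ρ ∧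
      ∀ s : ℝ, |s| ≤ 1 → ‖(D.hol θ).linear (ψ (s • u))‖ < r := by
  obtain ⟨f, hf⟩ := hsd
  obtain ⟨C₁, hC₁, hfC⟩ := (f.symm.toLinearMap.toContinuousLinearMap).bound
  obtain ⟨C₂, hC₂, hψC⟩ := ((f.toLinearMap ∘ₗ ψ).toContinuousLinearMap).bound
  set ε : ℝ := r / (2 * C₁) with hε
  have hε0 : 0 < ε := by positivity
  obtain ⟨η, hη, hV⟩ := hf ε hε0
  refine ⟨η / C₂, by positivity, fun ρ hρ hρ' θ => ?_⟩
  set L : AffModel n ≃ₗ[ℝ] AffModel n := (D.hol θ).linear with hL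
  -- The hypothesis is applied to the inverse of the linear part: a lower bound for `L⁻¹` on `V` is
  -- an upper bound for `L` on `L⁻¹ V`.
  obtain ⟨V, hVd, hVη⟩ := hV L.symm (by
    refine ⟨(D.hol θ)⁻¹, ⟨θ⁻¹, map_inv _ _⟩, rfl⟩)
  have hscale : ∀ v ∈ V, η * ‖f v‖ ≤ ε * ‖f (L.symm v)‖ := by
    intro v hv
    by_cases h0 : ‖f v‖ = 0
    · rw [h0, mul_zero]
      positivity
    have hpos : 0 < ‖f v‖ := lt_of_le_of_ne (norm_nonneg _) (Ne.symm h0)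
    have := hVη ((ε / ‖f v‖) • v) (V.smul_mem _ hv) (by
      rw [map_smul, norm_smul, Real.norm_of_nonneg (by positivity)]
      field_simp)
    rw [map_smul, map_smul, norm_smul, Real.norm_of_nonneg (by positivity), div_mul_eq_mul_div,
      le_div_iff₀ hpos] at this
    exact this
  -- The dimensions `n - d` and `d + 1` add up to more than `n`.
  have hne : V.map (L.symm : AffModel n →ₗ[ℝ] AffModel n) ⊓ LinearMap.range ψ ≠ ⊥ := by
    intro h
    have h1 := Submodule.finrank_sup_add_finrank_inf_eq
      (V.map (L.symm : AffModel n →ₗ[ℝ] AffModel n)) (LinearMap.range ψ)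
    rw [h, finrank_bot, LinearMap.finrank_range_of_inj hψ, hA,
      LinearEquiv.finrank_map_eq L.symm V] at h1
    have h2 := Submodule.finrank_le
      (V.map (L.symm : AffModel n →ₗ[ℝ] AffModel n) ⊔ LinearMap.range ψ)
    rw [finrank_euclideanSpace_fin] at h2
    omega
  obtain ⟨w, hw, hw0⟩ := Submodule.exists_mem_ne_zero_of_ne_bot hne
  obtain ⟨⟨v, hv, rfl⟩, u₀, hu₀⟩ := hw
  have hu₀0 : u₀ ≠ 0 := by
    rintro rfl
    exact hw0 (by rw [← hu₀, map_zero])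
  have hnu : 0 < ‖u₀‖ := norm_pos_iff.2 hu₀0
  refine ⟨(ρ / ‖u₀‖) • u₀, ?_, fun s hs => ?_⟩
  · rw [norm_smul, Real.norm_of_nonneg (by positivity)]
    field_simp
  · set c : ℝ := s * (ρ / ‖u₀‖) with hc
    have hLu : L (ψ (s • (ρ / ‖u₀‖) • u₀)) = c • v := by
      rw [smul_smul, map_smul, hu₀, map_smul]
      simp [hc]
    have hsym : L.symm (c • v) = ψ (s • (ρ / ‖u₀‖) • u₀) := by
      rw [← hLu, L.symm_apply_apply]
    change ‖L (ψ (s • (ρ / ‖u₀‖) • u₀))‖ < r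
    rw [hLu]
    have h1 := hscale (c • v) (V.smul_mem _ hv)
    rw [hsym] at h1
    have h2 := hψC (s • (ρ / ‖u₀‖) • u₀)
    have h3 : ‖s • (ρ / ‖u₀‖) • u₀‖ ≤ ρ := by
      rw [norm_smul, norm_smul, Real.norm_of_nonneg (by positivity : 0 ≤ ρ / ‖u₀‖),
        div_mul_cancel₀ _ hnu.ne', Real.norm_eq_abs]
      nlinarith
    have h4 : ‖f (ψ (s • (ρ / ‖u₀‖) • u₀))‖ ≤ η := by
      refine le_trans h2 ?_
      calc C₂ * ‖s • (ρ / ‖u₀‖) • u₀‖ ≤ C₂ * (η / C₂) := by gcongr; exact h3.trans hρ'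
        _ = η := by field_simp
    have h5 : ‖f (c • v)‖ ≤ ε := by
      have : η * ‖f (c • v)‖ ≤ η * ε := by
        calc _ ≤ ε * ‖f (ψ (s • (ρ / ‖u₀‖) • u₀))‖ := h1
          _ ≤ ε * η := by gcongr
          _ = η * ε := mul_comm _ _
      exact le_of_mul_le_mul_left this hη
    have h6 := hfC (f (c • v))
    have h7 : ‖c • v‖ ≤ C₁ * ‖f (c • v)‖ := by simpa using h6
    calc ‖c • v‖ ≤ C₁ * ε := h7.trans (by gcongr)
      _ = r / 2 := by rw [hε]; field_simp
      _ < r := by linarith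

/-- Let the segment `[b, x)` be contained in the star domain but not its endpoint `x`. Near `x`,
it is not possible to choose in every direction a segment of fixed small length in the star domain,
starting at a point of `[b, x)`, and ending in a fixed compact part of the star domain. -/
theorem not_eventually_segment_subset {d : ℕ} [T2Space M] [CompactSpace M] [PreconnectedSpace M]
    [SimplyConnectedSpace X] (hp : IsCoveringMap p) (D : DevelopmentPair n p)
    (hsd : AffineShrinkableDimLE D.holonomyGroup d)
    {A : Type*} [NormedAddCommGroup A] [NormedSpace ℝ A] [FiniteDimensional ℝ A]
    (hA : Module.finrank ℝ A = d + 1) {ι : A →ᵃ[ℝ] AffModel n} (hι : Function.Injective ι)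
    {x₀ : X} {b x : A} (hb : D.dev x₀ = ι b)
    (hbx : ∀ t ∈ Ico (0 : ℝ) 1, ι (AffineMap.lineMap b x t) ∈ starDomain D.dev x₀)
    (hx : ι x ∉ starDomain D.dev x₀) :
    ∃ ρ₀ > 0, ∀ ρ > 0, ρ ≤ ρ₀ → ∀ C : Set A, IsCompact C → C ⊆ ι ⁻¹' starDomain D.dev x₀ →
      ¬ ∀ᶠ t in 𝓝[<] (1 : ℝ), ∀ u : A, ‖u‖ = ρ → ∃ u', (u' = u ∨ u' = -u) ∧
        (∀ s ∈ Icc (0 : ℝ) 1, ι (AffineMap.lineMap b x t + s • u') ∈ starDomain D.dev x₀) ∧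
        AffineMap.lineMap b x t + u' ∈ C := by
  have hdev := D.isLocalHomeomorph_dev hp
  have := hp.t2Space
  have := hdev.locallyPathConnectedSpace
  have hιc : Continuous ι := ι.continuous_of_finiteDimensional
  -- Along an ultrafilter, every family that is eventually in a compact set converges, which
  -- replaces repeated passage to subsequences.
  set l : Ultrafilter ℝ := Ultrafilter.of (𝓝[<] (1 : ℝ)) with hl
  have hl1 : (l : Filter ℝ) ≤ 𝓝[<] 1 := Ultrafilter.of_le _
  set ex : ℝ → X := fun t => starExp D.dev x₀ (ι (AffineMap.lineMap b x t)) with hex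
  have hIco : ∀ᶠ t in (l : Filter ℝ), t ∈ Ico (0 : ℝ) 1 :=
    hl1 (mem_of_superset (Ioo_mem_nhdsLT zero_lt_one) Ioo_subset_Ico_self)
  obtain ⟨m, -, hm⟩ := isCompact_univ.ultrafilter_le_nhds (l.map fun t => p (ex t)) (by simp)
  have hm' : Tendsto (fun t => p (ex t)) l (𝓝 m) := hm
  obtain ⟨y₀, hy₀⟩ := hp.surjective_of_preconnectedSpace m
  set c := hp.isLocalHomeomorph.localInverseAt y₀ with hc
  have hcs : m ∈ c.source := hy₀ ▸ hp.isLocalHomeomorph.apply_self_mem_localInverseAt_source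
  have hcm : c m = y₀ := by
    rw [← hy₀]; exact hp.isLocalHomeomorph.localInverseAt_apply_self
  set q : ℝ → X := fun t => c (p (ex t)) with hq
  have hqt : Tendsto q l (𝓝 y₀) := by
    have := (c.continuousAt hcs).tendsto.comp hm'
    rwa [hcm] at this
  have hqp : ∀ᶠ t in (l : Filter ℝ), p (ex t) = p (q t) := by
    filter_upwards [hm'.eventually_mem (c.open_source.mem_nhds hcs)] with t ht
    exact (hp.isLocalHomeomorph.apply_localInverseAt_of_mem ht).symm
  -- `θ t` brings the lifted point `ex t` back to `q t`, which tends to `y₀`; the value `1` is a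
  -- mere default.
  have hθ : ∀ t, ∃ θ : deckGroup p, p (ex t) = p (q t) → θ.1 (ex t) = q t := by
    intro t
    by_cases h : p (ex t) = p (q t)
    · obtain ⟨θ, hθ⟩ := exists_deckGroup_apply_eq hp h
      exact ⟨θ, fun _ => hθ⟩
    · exact ⟨1, fun h' => absurd h' h⟩
  choose θ hθ using hθ
  set e := hdev.localInverseAt y₀ with he
  have hes : D.dev y₀ ∈ e.source := hdev.apply_self_mem_localInverseAt_source
  obtain ⟨R, hR, hRe⟩ := Metric.nhds_basis_closedBall.mem_iff.1 (e.open_source.mem_nhds hes)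
  obtain ⟨ρ₀, hρ₀, hdir⟩ := D.exists_forall_deckGroup_direction hsd hA
    (ψ := ι.linear) (ι.linear_injective_iff.2 hι) (half_pos hR)
  refine ⟨ρ₀, hρ₀, fun ρ hρ hρρ₀ C hC hCΩ hev => hx ?_⟩
  have hdevq : ∀ᶠ t in (l : Filter ℝ), D.dev (q t) ∈ Metric.ball (D.dev y₀) (R / 2) :=
    ((hdev.continuous.tendsto y₀).comp hqt).eventually_mem (Metric.ball_mem_nhds _ (half_pos hR))
  have hqe : ∀ᶠ t in (l : Filter ℝ), q t ∈ e.target :=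
    hqt.eventually_mem (e.open_target.mem_nhds hdev.self_mem_localInverseAt_target)
  set K : Set X := e '' Metric.closedBall (D.dev y₀) R
  have hK : IsCompact K := (isCompact_closedBall _ _).image_of_continuousOn (e.continuousOn.mono hRe)
  set K' : Set X := (fun a => starExp D.dev x₀ (ι a)) '' C
  have hcont : ContinuousOn (fun a => starExp D.dev x₀ (ι a)) (ι ⁻¹' starDomain D.dev x₀) :=
    (continuousOn_starExp hdev x₀).comp hιc.continuousOn fun _ h => h
  have hK' : IsCompact K' := hC.image_of_continuousOn (hcont.mono hCΩ)
  -- Moved by `θ t`, the lifted segment in the contracted direction starts at `q t` and develops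
  -- into the ball of radius `R`: one half of `R` bounds the distance of the starting point, the
  -- other the displacement. Hence it is the image under `e` of its development and stays in `K`.
  have hmain : ∀ᶠ t in (l : Filter ℝ), ∃ a ∈ K', (θ t).1 a ∈ K := by
    filter_upwards [hIco, hqp, hdevq, hqe, hl1 hev] with t htI htp htq hte htu
    obtain ⟨u, hu, hur⟩ := hdir ρ hρ hρρ₀ (θ t)
    obtain ⟨u', hu', hseg, hend⟩ := htu u hu
    have hur' : ∀ s ∈ Icc (0 : ℝ) 1, ‖(D.hol (θ t)).linear (ι.linear (s • u'))‖ < R / 2 := by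
      intro s hs
      rcases hu' with rfl | rfl
      · exact hur s (abs_le.2 ⟨by linarith [hs.1], hs.2⟩)
      · have := hur (-s) (by rw [abs_neg]; exact abs_le.2 ⟨by linarith [hs.1], hs.2⟩)
        rwa [neg_smul, ← smul_neg] at this
    set z := AffineMap.lineMap b x t
    have hθt := hθ t htp
    let σ₁ : ℝ → X := fun s => (θ t).1 (starExp D.dev x₀ (ι (z + s • u')))
    let w : ℝ → AffModel n := fun s => D.dev (q t) + (D.hol (θ t)).linear (ι.linear (s • u'))
    have hwball : ∀ s ∈ Icc (0 : ℝ) 1, w s ∈ Metric.closedBall (D.dev y₀) R := by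
      intro s hs
      have h1 := hur' s hs
      have h2 := htq
      rw [Metric.mem_ball, dist_eq_norm] at h2
      rw [Metric.mem_closedBall, dist_eq_norm]
      calc ‖w s - D.dev y₀‖
          = ‖(D.dev (q t) - D.dev y₀) + (D.hol (θ t)).linear (ι.linear (s • u'))‖ := by
            congr 1; simp only [w]; abel
        _ ≤ _ := norm_add_le _ _
        _ ≤ R := by linarith
    have hσ₁ : ContinuousOn σ₁ (Icc 0 1) := by
      refine (θ t).1.continuous.comp_continuousOn ?_
      exact hcont.comp (by fun_prop) hseg
    have hw : Continuous w := by
      have h1 : Continuous (D.hol (θ t)).linear :=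
        (D.hol (θ t)).linear.toLinearMap.continuous_of_finiteDimensional
      have h2 : Continuous ι.linear := ι.linear.continuous_of_finiteDimensional
      fun_prop
    have hσ₂ : ContinuousOn (fun s => e (w s)) (Icc 0 1) :=
      e.continuousOn.comp hw.continuousOn fun s hs => hRe (hwball s hs)
    have hdevσ : ∀ s ∈ Icc (0 : ℝ) 1, D.dev (σ₁ s) = w s := by
      intro s hs
      have h1 : D.dev (q t) = D.hol (θ t) (ι z) := by
        rw [← hθt, D.equivariant, hex]
        simp only
        rw [apply_starExp (hbx t htI)]
      simp only [σ₁, w]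
      rw [D.equivariant, apply_starExp (hseg s hs), h1, add_comm z, ← vadd_eq_add (s • u'),
        ι.map_vadd, (D.hol (θ t)).map_vadd, vadd_eq_add, add_comm]
    have heq : EqOn σ₁ (fun s => e (w s)) (Icc 0 1) := by
      refine (T2Space.isSeparatedMap D.dev).eqOn_of_comp_eqOn hdev.isLocallyInjective
        isPreconnected_Icc hσ₁ hσ₂ ?_ (left_mem_Icc.2 zero_le_one) ?_
      · intro s hs
        simp only [Function.comp_apply]
        rw [hdevσ s hs, hdev.apply_localInverseAt_of_mem (hRe (hwball s hs))]
      · have h0 : (0 : ℝ) ∈ Icc (0 : ℝ) 1 := left_mem_Icc.2 zero_le_one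
        have h1 : σ₁ 0 = q t := by
          simp only [σ₁, zero_smul, add_zero]
          exact hθt
        refine hdev.injOn_localInverseAt_target (h1 ▸ hte) (e.map_source (hRe (hwball 0 h0))) ?_
        rw [hdevσ 0 h0, hdev.apply_localInverseAt_of_mem (hRe (hwball 0 h0))]
    have h1 : (1 : ℝ) ∈ Icc (0 : ℝ) 1 := right_mem_Icc.2 zero_le_one
    refine ⟨starExp D.dev x₀ (ι (z + u')), ⟨_, hend, rfl⟩, ?_⟩
    have := heq h1
    simp only [σ₁, one_smul] at this
    rw [this]
    exact ⟨_, hwball 1 h1, by simp⟩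
  have hmain' : ∀ t, ∃ a : X, (∃ a ∈ K', (θ t).1 a ∈ K) → a ∈ K' ∧ (θ t).1 a ∈ K := by
    intro t
    by_cases h : ∃ a ∈ K', (θ t).1 a ∈ K
    · obtain ⟨a, ha⟩ := h
      exact ⟨a, fun _ => ha⟩
    · exact ⟨x₀, fun h' => absurd h' h⟩
  choose a ha using hmain'
  obtain ⟨a₀, -, ha₀⟩ := hK'.ultrafilter_le_nhds (l.map a)
    (le_principal_iff.2 (hmain.mono fun t ht => (ha t ht).1))
  obtain ⟨w₀, -, hw₀⟩ := hK.ultrafilter_le_nhds (l.map fun t => (θ t).1 (a t))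
    (le_principal_iff.2 (hmain.mono fun t ht => (ha t ht).2))
  -- Both `a t` and its translate converge, so `θ t` is eventually some `θ₀`, and `ex t` tends to
  -- the translate of `y₀` by the inverse of `θ₀`.
  obtain ⟨θ₀, hθ₀⟩ := exists_eventually_eq_of_tendsto_deckGroup hp (l := (l : Filter ℝ))
    (θ := θ) (a := a) ha₀ hw₀
  have hext : Tendsto ex l (𝓝 (θ₀.1.symm y₀)) := by
    refine ((θ₀.1.symm.continuous.tendsto y₀).comp hqt).congr' ?_
    filter_upwards [hθ₀, hqp] with t ht htp
    rw [Function.comp_apply, ← hθ t htp, ht, Homeomorph.symm_apply_apply]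
  have hline : ∀ t : ℝ, ι (AffineMap.lineMap b x t) = AffineMap.lineMap (D.dev x₀) (ι x) t := by
    intro t
    rw [hb, AffineMap.apply_lineMap]
  refine mem_starDomain_of_tendsto hdev (fun t ht => hline t ▸ hbx t ht) hl1 ?_
    (q := θ₀.1.symm y₀)
  simpa only [hex, hline] using hext

end DevelopmentPair

/-! ### Filling in a simplex from an extremal missing point -/

section CornerSimplex

variable {κ : Type*} [Fintype κ]

/-- The simplex of points with nonnegative coordinates whose sum is at most `c`. -/
def cornerSimplex (κ : Type*) [Fintype κ] (c : ℝ) : Set (EuclideanSpace ℝ κ) :=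
  {a | (∀ k, 0 ≤ a k) ∧ ∑ k, a k ≤ c}

theorem isCompact_cornerSimplex (c : ℝ) : IsCompact (cornerSimplex κ c) := by
  have h1 : IsCompact (WithLp.toLp 2 '' Set.pi univ fun _ : κ => Icc (0 : ℝ) c) :=
    (isCompact_univ_pi fun _ => isCompact_Icc).image (PiLp.continuous_toLp 2 _)
  refine h1.of_isClosed_subset ?_ ?_
  · have : cornerSimplex κ c = (⋂ k, {a | 0 ≤ a k}) ∩ {a | ∑ k, a k ≤ c} := by
      ext a; simp [cornerSimplex]
    rw [this]
    refine (isClosed_iInter fun k => isClosed_le (by fun_prop) (by fun_prop)).inter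
      (isClosed_le (by fun_prop) (by fun_prop))
  · intro a ha
    refine ⟨WithLp.ofLp a, fun k _ => ⟨ha.1 k, ?_⟩, rfl⟩
    exact (Finset.single_le_sum (fun j _ => ha.1 j) (Finset.mem_univ k)).trans ha.2

theorem convex_cornerSimplex (c : ℝ) : Convex ℝ (cornerSimplex κ c) := by
  intro a ha b hb s t hs ht hst
  refine ⟨fun k => ?_, ?_⟩
  · have := ha.1 k; have := hb.1 k
    simp only [PiLp.add_apply, PiLp.smul_apply, smul_eq_mul]
    positivity
  · simp only [PiLp.add_apply, PiLp.smul_apply, smul_eq_mul, Finset.sum_add_distrib,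
      ← Finset.mul_sum]
    calc _ ≤ s * c + t * c := by gcongr; exacts [ha.2, hb.2]
      _ = c := by rw [← add_mul, hst, one_mul]

/-- An open set contains a whole simplex if it contains all its points outside the relative
interior of one side, and if it has no boundary point, visible from an interior point `b`, with
the property that points near it on the segment from `b` can be joined within the open set, in one
of any two opposite directions, to points of a compact part. -/
theorem cornerSimplex_subset {Ω : Set (EuclideanSpace ℝ κ)} (hΩ : IsOpen Ω)
    {b : EuclideanSpace ℝ κ} (hb0 : ∀ k, 0 ≤ b k) (hb1 : ∑ k, b k < 1)
    (hface : ∀ a ∈ cornerSimplex κ 1, (∑ k, a k < 1 ∨ ∃ k, a k = 0) → a ∈ Ω)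
    (hkey : ∀ x ∉ Ω, (∀ t ∈ Ico (0 : ℝ) 1, AffineMap.lineMap b x t ∈ Ω) →
      ∃ ρ₀ > 0, ∀ ρ > 0, ρ ≤ ρ₀ → ∀ C : Set (EuclideanSpace ℝ κ), IsCompact C → C ⊆ Ω →
      ¬ ∀ᶠ t in 𝓝[<] (1 : ℝ), ∀ u : EuclideanSpace ℝ κ, ‖u‖ = ρ → ∃ u', (u' = u ∨ u' = -u) ∧
        (∀ s ∈ Icc (0 : ℝ) 1, AffineMap.lineMap b x t + s • u' ∈ Ω) ∧
        AffineMap.lineMap b x t + u' ∈ C) :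
    cornerSimplex κ 1 ⊆ Ω := by
  intro x' hx'
  by_contra hx'Ω
  -- The simplex is slightly enlarged beyond the exceptional side.
  have hfacec : IsCompact (cornerSimplex κ 1 ∩ ⋃ k, {a | a k = 0}) := by
    refine (isCompact_cornerSimplex 1).inter_right ?_
    exact isClosed_iUnion_of_finite fun k => isClosed_eq (by fun_prop) continuous_const
  have hev : ∀ᶠ τ in 𝓝 (0 : ℝ), ∀ a ∈ cornerSimplex κ 1 ∩ ⋃ k, {a | a k = 0},
      (1 + τ) • a ∈ Ω := by
    refine hfacec.eventually_forall_of_forall_eventually fun a ha => ?_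
    have hc : Continuous fun q : ℝ × EuclideanSpace ℝ κ => (1 + q.1) • q.2 := by fun_prop
    refine hc.continuousAt.eventually_mem (hΩ.mem_nhds ?_)
    obtain ⟨k, hk⟩ := mem_iUnion.1 ha.2
    simpa using hface a ha.1 (Or.inr ⟨k, hk⟩)
  obtain ⟨τ₀, hτ₀, hτ₀'⟩ := Metric.eventually_nhds_iff.1 hev
  set τ : ℝ := min (τ₀ / 2) 1
  have hτ : 0 < τ := lt_min (half_pos hτ₀) one_pos
  have hτ1 : τ ≤ 1 := min_le_right _ _
  have hτface : ∀ a ∈ cornerSimplex κ (1 + τ), ∀ k, a k = 0 → a ∈ Ω := by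
    intro a ha k hk
    have h1 := hτ₀' (y := τ) (by
      rw [Real.dist_eq, sub_zero, abs_of_pos hτ]
      exact (min_le_left _ _).trans_lt (half_lt_self hτ₀)) ((1 + τ)⁻¹ • a)
      ⟨⟨fun j => ?_, ?_⟩, mem_iUnion.2 ⟨k, by simp [hk]⟩⟩
    · rwa [smul_smul, mul_inv_cancel₀ (by positivity), one_smul] at h1
    · have := ha.1 j
      simp only [PiLp.smul_apply, smul_eq_mul]
      positivity
    · simp only [PiLp.smul_apply, smul_eq_mul, ← Finset.mul_sum]
      rw [inv_mul_le_iff₀ (by positivity), mul_one]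
      exact ha.2
  set S : EuclideanSpace ℝ κ → ℝ := fun a => ∑ k, a k with hS
  have hSc : Continuous S := by fun_prop
  have hSadd : ∀ a c, S (a + c) = S a + S c := fun a c => by simp [hS, Finset.sum_add_distrib]
  have hSsmul : ∀ (s : ℝ) a, S (s • a) = s * S a := fun s a => by simp [hS, Finset.mul_sum]
  have hSsub : ∀ a c, S (a - c) = S a - S c := fun a c => by simp [hS]
  obtain ⟨R, hR, hbd⟩ : ∃ R > 0, ∀ a ∈ cornerSimplex κ (1 + τ), ‖a - b‖ ^ 2 ≤ R := by
    obtain ⟨R, hR⟩ := ((isCompact_cornerSimplex (κ := κ) (1 + τ)).image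
      (f := fun a => ‖a - b‖ ^ 2) (by fun_prop)).bddAbove
    exact ⟨max R 1, by positivity, fun a ha => (hR ⟨a, ha, rfl⟩).trans (le_max_left _ _)⟩
  -- With `K * R = τ' / 4` the quadratic term of `g` is too small to lift `g` to `-1` where the
  -- coordinate sum is `1 + τ`, or to stop `g` from staying above `g x` on `[b, x)`.
  set τ' : ℝ := min τ (1 - S b)
  have hτ' : 0 < τ' := lt_min hτ (sub_pos.2 hb1)
  set K : ℝ := τ' / (4 * R) with hK
  have hK0 : 0 < K := by positivity
  have hKR : K * R = τ' / 4 := by rw [hK]; field_simp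
  have hτ'τ : τ' ≤ τ := min_le_left _ _
  have hτ'b : τ' ≤ 1 - S b := min_le_right _ _
  -- Up to a constant, `g` is `K` times the squared distance to `b + (1 / (2 * K)) • (1, …, 1)`, so
  -- its sublevel sets are balls.
  set g : EuclideanSpace ℝ κ → ℝ := fun a => -S a + K * ‖a - b‖ ^ 2 with hg
  have hgc : Continuous g := by fun_prop
  have hKle : ∀ a ∈ cornerSimplex κ (1 + τ), K * ‖a - b‖ ^ 2 ≤ τ' / 4 := fun a ha =>
    hKR ▸ mul_le_mul_of_nonneg_left (hbd a ha) hK0.le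
  have hsub : cornerSimplex κ 1 ⊆ cornerSimplex κ (1 + τ) := fun a ha =>
    ⟨ha.1, ha.2.trans (by linarith)⟩
  obtain ⟨x, ⟨hxT, hxΩ⟩, hmax⟩ := ((isCompact_cornerSimplex (κ := κ) (1 + τ)).diff hΩ).exists_isMaxOn
    ⟨x', hsub hx', hx'Ω⟩ hgc.continuousOn
  have hmem : ∀ a ∈ cornerSimplex κ (1 + τ), g x < g a → a ∈ Ω := fun a ha hga => by
    by_contra haΩ
    exact absurd (hmax ⟨ha, haΩ⟩) (not_le.2 hga)
  have hgx' : -1 ≤ g x' := by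
    have h1 : S x' ≤ 1 := hx'.2
    have : 0 ≤ K * ‖x' - b‖ ^ 2 := by positivity
    simp only [hg]
    linarith
  have hxS : S x < 1 + τ := by
    have h1 : g x' ≤ g x := hmax ⟨hsub hx', hx'Ω⟩
    have h2 := hKle x hxT
    have h3 : g x = -S x + K * ‖x - b‖ ^ 2 := rfl
    linarith
  have hxS1 : 1 ≤ S x := by
    by_contra h
    exact hxΩ (hface x ⟨hxT.1, (not_le.1 h).le⟩ (Or.inl (not_le.1 h)))
  have hxpos : ∀ k, 0 < x k := fun k =>
    lt_of_le_of_ne (hxT.1 k) fun h => hxΩ (hτface x hxT k h.symm)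
  have hbT : b ∈ cornerSimplex κ (1 + τ) := hsub ⟨hb0, hb1.le⟩
  have hlineT : ∀ t ∈ Ico (0 : ℝ) 1, AffineMap.lineMap b x t ∈ cornerSimplex κ (1 + τ) :=
    fun t ht => (convex_cornerSimplex _).lineMap_mem hbT hxT ⟨ht.1, ht.2.le⟩
  have hlineg : ∀ t ∈ Ico (0 : ℝ) 1, g x < g (AffineMap.lineMap b x t) := by
    intro t ht
    have h1 : AffineMap.lineMap b x t - b = t • (x - b) := by
      simp [AffineMap.lineMap_apply]
    have h2 : S (AffineMap.lineMap b x t) = S b + t * (S x - S b) := by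
      rw [← hSsub, ← hSsmul, ← h1, hSsub]; ring
    have h3 : ‖AffineMap.lineMap b x t - b‖ ^ 2 = t ^ 2 * ‖x - b‖ ^ 2 := by
      rw [h1, norm_smul, mul_pow, Real.norm_eq_abs, sq_abs]
    have h4 := hKle x hxT
    have h5 : 0 ≤ K * ‖x - b‖ ^ 2 := by positivity
    have h6 : g (AffineMap.lineMap b x t) - g x =
        (1 - t) * ((S x - S b) - (1 + t) * (K * ‖x - b‖ ^ 2)) := by
      simp only [hg]
      rw [h2, h3]
      ring
    have h7 : 0 < (S x - S b) - (1 + t) * (K * ‖x - b‖ ^ 2) := by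
      nlinarith [ht.2]
    have := mul_pos (sub_pos.2 ht.2) h7
    linarith
  obtain ⟨ρ₀, hρ₀, hcontra⟩ := hkey x hxΩ fun t ht => hmem _ (hlineT t ht) (hlineg t ht)
  have hopen : IsOpen ((⋂ k, {a : EuclideanSpace ℝ κ | 0 < a k}) ∩ {a | S a < 1 + τ}) :=
    (isOpen_iInter_of_finite fun k => isOpen_lt continuous_const (by fun_prop)).inter
      (isOpen_lt hSc continuous_const)
  obtain ⟨r, hr, hball⟩ := Metric.isOpen_iff.1 hopen x ⟨mem_iInter.2 hxpos, hxS⟩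
  have hballT : Metric.ball x r ⊆ cornerSimplex κ (1 + τ) := fun a ha =>
    ⟨fun k => (mem_iInter.1 (hball ha).1 k).le, (hball ha).2.le⟩
  set ρ : ℝ := min ρ₀ (r / 2)
  have hρ : 0 < ρ := lt_min hρ₀ (half_pos hr)
  have hρr : ρ ≤ r / 2 := min_le_right _ _
  have hKρ : 0 < K * ρ ^ 2 := by positivity
  -- The compact part is cut out by the gain `K * ρ ^ 2` which the quadratic term gives a vector of
  -- length `ρ`.
  refine hcontra ρ hρ (min_le_left _ _) {a ∈ cornerSimplex κ (1 + τ) | g x + K * ρ ^ 2 ≤ g a}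
    ((isCompact_cornerSimplex _).inter_right (isClosed_le continuous_const hgc))
    (fun a ha => hmem a ha.1 (by linarith [ha.2])) ?_
  have hnear : ∀ᶠ t in 𝓝[<] (1 : ℝ), AffineMap.lineMap b x t ∈ Metric.ball x (r / 2) := by
    have hc : Continuous fun t : ℝ => AffineMap.lineMap b x t := AffineMap.lineMap_continuous
    refine (hc.continuousAt (x := (1 : ℝ))).continuousWithinAt.eventually_mem ?_
    simpa using Metric.ball_mem_nhds x (half_pos hr)
  filter_upwards [hnear, mem_of_superset (Ioo_mem_nhdsLT zero_lt_one) Ioo_subset_Ico_self]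
    with t htx ht u hu
  have hgz := hlineg t ht
  set z := AffineMap.lineMap b x t
  set ℓ : EuclideanSpace ℝ κ → ℝ := fun v => -S v + 2 * K * inner ℝ (z - b) v with hℓ
  have hgadd : ∀ v, g (z + v) = g z + ℓ v + K * ‖v‖ ^ 2 := by
    intro v
    simp only [hg, hℓ]
    rw [hSadd, add_sub_right_comm, norm_add_sq_real]
    ring
  have hℓsmul : ∀ (s : ℝ) v, ℓ (s • v) = s * ℓ v := by
    intro s v
    simp only [hℓ, hSsmul, inner_smul_right]
    ring
  -- The linear part `ℓ` of the increment of `g` is odd, hence nonnegative on `u` or on `-u`.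
  obtain ⟨u', hu', hℓu'⟩ : ∃ u', (u' = u ∨ u' = -u) ∧ 0 ≤ ℓ u' := by
    rcases le_total 0 (ℓ u) with h | h
    · exact ⟨u, Or.inl rfl, h⟩
    · refine ⟨-u, Or.inr rfl, ?_⟩
      rw [← neg_one_smul ℝ u, hℓsmul]
      linarith
  have hnu' : ‖u'‖ = ρ := by
    rcases hu' with rfl | rfl
    · exact hu
    · rw [norm_neg, hu]
  have hT : ∀ s ∈ Icc (0 : ℝ) 1, z + s • u' ∈ cornerSimplex κ (1 + τ) := by
    intro s hs
    refine hballT ?_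
    rw [Metric.mem_ball, dist_eq_norm] at htx ⊢
    have h1 : ‖s • u'‖ ≤ ρ := by
      rw [norm_smul, hnu', Real.norm_of_nonneg hs.1]
      nlinarith [hs.2]
    calc ‖z + s • u' - x‖ = ‖(z - x) + s • u'‖ := by rw [add_sub_right_comm]
      _ ≤ ‖z - x‖ + ‖s • u'‖ := norm_add_le _ _
      _ < r := by linarith
  refine ⟨u', hu', fun s hs => hmem _ (hT s hs) ?_, ?_, ?_⟩
  · rw [hgadd, hℓsmul]
    have h1 := mul_nonneg hs.1 hℓu'
    have h2 : 0 ≤ K * ‖s • u'‖ ^ 2 := by positivity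
    linarith
  · simpa using hT 1 (right_mem_Icc.2 zero_le_one)
  · rw [hgadd, hnu']
    linarith

end CornerSimplex

theorem eVariationOn_lineMap_le {E : Type*} [NormedAddCommGroup E] [NormedSpace ℝ E] (a b : E) :
    eVariationOn (fun t : I => (AffineMap.lineMap a b (t : ℝ) : E)) univ ≤ edist a b := by
  have h1 := (lipschitzWith_lineMap (𝕜 := ℝ) a b).lipschitzOnWith (s := univ)
  have h2 := h1.comp_eVariationOn_le (g := fun t : I => (t : ℝ)) (s := univ)
    (fun t _ => mem_univ _)
  have h3 := MonotoneOn.eVariationOn_eq (f := fun t : I => (t : ℝ)) (s := univ)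
    (fun a _ b _ hab => hab) (mem_univ 0) (mem_univ 1)
  have h4 : (univ : Set I) ∩ Icc 0 1 = univ := by
    exact eq_univ_of_forall fun t => ⟨mem_univ t, t.2.1, t.2.2⟩
  rw [h4] at h3
  calc _ ≤ (nndist a b : ENNReal) * eVariationOn (fun t : I => (t : ℝ)) univ := h2
    _ ≤ (nndist a b : ENNReal) * 1 := by gcongr; simpa using h3.le
    _ = edist a b := by rw [mul_one, edist_nndist]

/-! ### Coordinates on a simplex with a vertex as origin -/

section SimplexChart

variable {E : Type*} [NormedAddCommGroup E] [NormedSpace ℝ E] {m : ℕ}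

/-- The affine parametrization of the span of a simplex with origin at the vertex `i`. -/
noncomputable def Affine.Simplex.vertexChart (s : Affine.Simplex ℝ E (m + 1)) (i : Fin (m + 2)) :
    EuclideanSpace ℝ (Fin (m + 1)) →ᵃ[ℝ] E :=
  (Fintype.linearCombination ℝ (fun k => s.points (i.succAbove k) - s.points i) ∘ₗ
    (WithLp.linearEquiv 2 ℝ (Fin (m + 1) → ℝ)).toLinearMap).toAffineMap +
    AffineMap.const ℝ _ (s.points i)

theorem Affine.Simplex.vertexChart_apply (s : Affine.Simplex ℝ E (m + 1)) (i : Fin (m + 2))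
    (a : EuclideanSpace ℝ (Fin (m + 1))) :
    s.vertexChart i a =
      ∑ k, a k • (s.points (i.succAbove k) - s.points i) + s.points i := by
  simp [Affine.Simplex.vertexChart, Fintype.linearCombination_apply]

theorem Affine.Simplex.vertexChart_injective (s : Affine.Simplex ℝ E (m + 1)) (i : Fin (m + 2)) :
    Function.Injective (s.vertexChart i) := by
  have h1 := (affineIndependent_iff_linearIndependent_vsub ℝ s.points i).1 s.independent
  have h2 := h1.comp (fun k : Fin (m + 1) => ⟨i.succAbove k, Fin.succAbove_ne i k⟩)
    (fun k k' h => Fin.succAbove_right_injective (Subtype.ext_iff.1 h))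
  have h3 := h2.fintypeLinearCombination_injective
  intro a b hab
  rw [vertexChart_apply, vertexChart_apply, add_left_inj] at hab
  have h4 : WithLp.ofLp a = WithLp.ofLp b := h3 (by
    simpa [Fintype.linearCombination_apply] using hab)
  exact WithLp.ofLp_injective 2 h4

/-- The barycentric coordinates of a point of the chart. -/
theorem Affine.Simplex.affineCombination_insertNth (s : Affine.Simplex ℝ E (m + 1))
    (i : Fin (m + 2)) (a : EuclideanSpace ℝ (Fin (m + 1))) :
    ∑ j, i.insertNth (α := fun _ => ℝ) (1 - ∑ k, a k) a j = 1 ∧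
    Finset.univ.affineCombination ℝ s.points
      (i.insertNth (α := fun _ => ℝ) (1 - ∑ k, a k) a) = s.vertexChart i a := by
  have h1 : ∑ j, i.insertNth (α := fun _ => ℝ) (1 - ∑ k, a k) a j = 1 := by
    rw [Fin.sum_univ_succAbove _ i]
    simp
  refine ⟨h1, ?_⟩
  rw [Finset.affineCombination_eq_linear_combination _ _ _ h1, Fin.sum_univ_succAbove _ i,
    vertexChart_apply]
  simp only [Fin.insertNth_apply_same, Fin.insertNth_apply_succAbove, smul_sub,
    Finset.sum_sub_distrib, ← Finset.sum_smul, sub_smul, one_smul]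
  abel

theorem Affine.Simplex.vertexChart_mem_closedInterior (s : Affine.Simplex ℝ E (m + 1))
    (i : Fin (m + 2)) {a : EuclideanSpace ℝ (Fin (m + 1))} (ha : a ∈ cornerSimplex _ 1) :
    s.vertexChart i a ∈ s.closedInterior := by
  obtain ⟨h1, h2⟩ := s.affineCombination_insertNth i a
  rw [← h2, affineCombination_mem_closedInterior_iff h1, Fin.forall_iff_succAbove i]
  have h0 : 0 ≤ ∑ k, a k := Finset.sum_nonneg fun k _ => ha.1 k
  refine ⟨by simpa using ⟨ha.2, h0⟩, fun k => ?_⟩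
  rw [Fin.insertNth_apply_succAbove]
  exact ⟨ha.1 k, (Finset.single_le_sum (fun j _ => ha.1 j) (Finset.mem_univ k)).trans ha.2⟩

theorem Affine.Simplex.exists_vertexChart_eq (s : Affine.Simplex ℝ E (m + 1))
    (i : Fin (m + 2)) {z : E} (hz : z ∈ s.closedInterior) :
    ∃ a ∈ cornerSimplex (Fin (m + 1)) 1, s.vertexChart i a = z := by
  obtain ⟨w, hw, hw01, rfl⟩ := hz
  have hsum := hw
  rw [Fin.sum_univ_succAbove _ i] at hsum
  refine ⟨WithLp.toLp 2 fun k => w (i.succAbove k), ⟨fun k => (hw01 _).1, ?_⟩, ?_⟩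
  · have := (hw01 i).1
    change ∑ k, w (i.succAbove k) ≤ 1
    linarith
  · rw [← (s.affineCombination_insertNth i _).2]
    congr 1
    funext j
    refine Fin.succAboveCases i ?_ (fun k => ?_) j
    · simp only [Fin.insertNth_apply_same]
      linarith
    · simp only [Fin.insertNth_apply_succAbove]

theorem Affine.Simplex.vertexChart_mem_interior (s : Affine.Simplex ℝ E (m + 1))
    (i : Fin (m + 2)) {a : EuclideanSpace ℝ (Fin (m + 1))} (ha : ∀ k, 0 < a k)
    (ha1 : ∑ k, a k < 1) : s.vertexChart i a ∈ s.interior := by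
  obtain ⟨h1, h2⟩ := s.affineCombination_insertNth i a
  rw [← h2, affineCombination_mem_interior_iff h1, Fin.forall_iff_succAbove i]
  have h0 : 0 < ∑ k, a k := Finset.sum_pos (fun k _ => ha k) Finset.univ_nonempty
  refine ⟨by simpa using ⟨ha1, h0⟩, fun k => ?_⟩
  rw [Fin.insertNth_apply_succAbove]
  exact ⟨ha k, (Finset.single_le_sum (fun j _ => (ha j).le) (Finset.mem_univ k)).trans_lt ha1⟩

theorem Affine.Simplex.vertexChart_mem_faceOpposite (s : Affine.Simplex ℝ E (m + 1))
    (i : Fin (m + 2)) {a : EuclideanSpace ℝ (Fin (m + 1))} (ha : a ∈ cornerSimplex _ 1)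
    {k : Fin (m + 1)} (hk : a k = 0) :
    s.vertexChart i a ∈ (s.faceOpposite (i.succAbove k)).closedInterior := by
  obtain ⟨h1, h2⟩ := s.affineCombination_insertNth i a
  have h3 := s.vertexChart_mem_closedInterior i ha
  rw [← h2, affineCombination_mem_closedInterior_iff h1] at h3
  rw [← h2, faceOpposite, affineCombination_mem_closedInterior_face_iff_mem_Icc _ _ h1]
  refine ⟨fun j _ => h3 j, fun j hj => ?_⟩
  have hj' : j = i.succAbove k := by simpa using hj
  rw [hj', Fin.insertNth_apply_succAbove, hk]

end SimplexChart

/-! ### The length metric and the topology of the universal covering -/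

namespace DevelopmentPair

variable {n : ℕ} {M X : Type*} [TopologicalSpace M] [ChartedSpace (AffModel n) M]
  [TopologicalSpace X] {p : X → M}

/-- The identity map from the universal covering space to itself with its induced distance. -/
def toCover (D : DevelopmentPair n p) (x : X) : D.Cover := x

/-- The identity map to the universal covering space from itself with its induced distance. -/
def ofCover (D : DevelopmentPair n p) (x : D.Cover) : X := x

/-- A path of length less than `r` develops into a ball of radius `r`, so by unique lifting it is
the image of its development under a local inverse of `dev` and cannot leave the given neighborhood.
-/
theorem continuous_ofCover [T2Space M] (hp : IsCoveringMap p) (D : DevelopmentPair n p) :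
    Continuous D.ofCover := by
  have hdev := D.isLocalHomeomorph_dev hp
  have := hp.t2Space
  rw [continuous_iff_continuousAt]
  intro q N hN
  set e := hdev.localInverseAt (D.ofCover q) with he
  have hes : D.dev (D.ofCover q) ∈ e.source := hdev.apply_self_mem_localInverseAt_source
  have heq : e (D.dev (D.ofCover q)) = D.ofCover q := hdev.localInverseAt_apply_self
  have hpre : e.source ∩ e ⁻¹' N ∈ 𝓝 (D.dev (D.ofCover q)) :=
    inter_mem (e.open_source.mem_nhds hes) ((e.continuousAt hes) (by rwa [heq]))
  obtain ⟨r, hr, hball⟩ := Metric.nhds_basis_eball.mem_iff.1 hpre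
  rw [Filter.mem_map, EMetric.mem_nhds_iff]
  refine ⟨r, hr, fun y hy => ?_⟩
  rw [Metric.mem_eball, edist_comm] at hy
  obtain ⟨γ, hγ⟩ : ∃ γ : Path (D.ofCover q) (D.ofCover y), D.pathLength γ < r :=
    iInf_lt_iff.1 hy
  have hin : ∀ t, D.dev (γ t) ∈ e.source ∩ e ⁻¹' N := fun t => hball (by
    rw [Metric.mem_eball]
    refine lt_of_le_of_lt ?_ hγ
    have := eVariationOn.edist_le (D.dev ∘ γ) (s := univ) (mem_univ t) (mem_univ 0)
    simpa [pathLength] using this)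
  have hγe : (γ : I → X) = fun t => e (D.dev (γ t)) := by
    refine (T2Space.isSeparatedMap D.dev).eq_of_comp_eq hdev.isLocallyInjective γ.continuous
      (e.continuousOn.comp_continuous (hdev.continuous.comp γ.continuous) fun t => (hin t).1)
      ?_ 0 ?_
    · funext t
      exact (hdev.apply_localInverseAt_of_mem (hin t).1).symm
    · rw [γ.source]
      exact heq.symm
  have h1 := (hin 1).2
  rw [mem_preimage, ← congrFun hγe 1, γ.target] at h1
  exact h1

/-- Near a point, a local inverse of `dev` lifts straight segments, which bounds the distance by
that of the developed points. -/
theorem continuous_toCover (hp : IsCoveringMap p) (D : DevelopmentPair n p) :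
    Continuous D.toCover := by
  have hdev := D.isLocalHomeomorph_dev hp
  rw [continuous_iff_continuousAt]
  intro q
  set e := hdev.localInverseAt q with he
  have hes : D.dev q ∈ e.source := hdev.apply_self_mem_localInverseAt_source
  rw [ContinuousAt, EMetric.tendsto_nhds]
  intro ε hε
  obtain ⟨r, hr, hball⟩ := Metric.isOpen_iff.1 e.open_source _ hes
  have h1 : ∀ᶠ y in 𝓝 q, D.dev y ∈ Metric.eball (D.dev q) ε :=
    hdev.continuous.continuousAt.eventually_mem (Metric.eball_mem_nhds _ hε)
  have h2 : ∀ᶠ y in 𝓝 q, D.dev y ∈ Metric.ball (D.dev q) r :=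
    hdev.continuous.continuousAt.eventually_mem (Metric.ball_mem_nhds _ hr)
  filter_upwards [h1, h2, e.open_target.mem_nhds hdev.self_mem_localInverseAt_target]
    with y hy1 hy2 hy3
  have hline : ∀ t : I, (AffineMap.lineMap (D.dev y) (D.dev q) (t : ℝ) : AffModel n) ∈ e.source :=
    fun t => hball ((convex_ball _ _).lineMap_mem hy2 (Metric.mem_ball_self hr) t.2)
  let γ : Path y q :=
    { toFun := fun t => e (AffineMap.lineMap (D.dev y) (D.dev q) (t : ℝ))
      continuous_toFun := e.continuousOn.comp_continuous
        (AffineMap.lineMap_continuous.comp continuous_subtype_val) hline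
      source' := by
        simp only [Icc.coe_zero, AffineMap.lineMap_apply_zero]
        refine hdev.injOn_localInverseAt_target (e.map_source (hball hy2)) hy3 ?_
        exact hdev.apply_localInverseAt_of_mem (hball hy2)
      target' := by
        simp only [Icc.coe_one, AffineMap.lineMap_apply_one]
        exact hdev.localInverseAt_apply_self }
  have hγ : (D.dev ∘ γ) = fun t : I => (AffineMap.lineMap (D.dev y) (D.dev q) (t : ℝ)) := by
    funext t
    exact hdev.apply_localInverseAt_of_mem (hline t)
  have h3 : D.pathLength γ ≤ edist (D.dev y) (D.dev q) := by
    rw [pathLength, hγ]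
    exact eVariationOn_lineMap_le _ _
  exact lt_of_le_of_lt ((iInf_le (fun γ : Path y q => D.pathLength γ) γ).trans h3) hy1

theorem completionDev_coe (D : DevelopmentPair n p) (x : D.Cover) :
    D.completionDev x = D.dev (D.ofCover x) :=
  UniformSpace.Completion.extension_coe D.lipschitzWith_coverDev.uniformContinuous x

end DevelopmentPair

namespace DevelopmentPair

variable {n : ℕ} {M X : Type*} [TopologicalSpace M] [ChartedSpace (AffModel n) M]
  [TopologicalSpace X] {p : X → M}

/-- A lift of a segment in a simplex `T` of the completion ends in the corresponding point of `T`,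
if this is true of its other points. -/
theorem coe_eq_of_lift (hp : IsCoveringMap p) (D : DevelopmentPair n p) {T : Set D.Completion}
    (hT : IsEmbedding (T.domRestrict D.completionDev)) {γ : C(I, X)}
    (hγ : ∀ t : I, t < 1 → ((D.toCover (γ t) : D.Cover) : D.Completion) ∈ T)
    {α : D.Completion} (hα : α ∈ T) (hend : D.completionDev α = D.dev (γ 1)) :
    α = (D.toCover (γ 1) : D.Cover) := by
  have hdev := D.isLocalHomeomorph_dev hp
  have hne : (𝓝[<] (1 : I)).NeBot := nhdsLT_neBot_of_exists_lt ⟨0, zero_lt_one⟩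
  classical
  -- The embedding makes `τ` tend to `α`, continuity of `γ` makes it tend to `γ 1`, and the
  -- completion is Hausdorff.
  let τ : I → T := fun t => if h : t < 1 then ⟨_, hγ t h⟩ else ⟨α, hα⟩
  have hτ : Tendsto τ (𝓝[<] 1) (𝓝 ⟨α, hα⟩) := by
    rw [hT.tendsto_nhds_iff]
    have h1 : Tendsto (fun t => D.dev (γ t)) (𝓝[<] 1) (𝓝 (D.dev (γ 1))) :=
      ((hdev.continuous.comp γ.continuous).tendsto 1).mono_left nhdsWithin_le_nhds
    change Tendsto _ _ (𝓝 (D.completionDev α))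
    rw [hend]
    refine h1.congr' ?_
    filter_upwards [self_mem_nhdsWithin] with t ht
    have ht' : t < 1 := ht
    simp only [Function.comp_apply, τ, dif_pos ht', domRestrict_apply]
    rw [completionDev_coe]
    rfl
  have h2 : Tendsto (fun t => (τ t : D.Completion)) (𝓝[<] 1) (𝓝 α) :=
    (continuous_subtype_val.tendsto _).comp hτ
  have h3 : Tendsto (fun t => ((D.toCover (γ t) : D.Cover) : D.Completion)) (𝓝[<] 1)
      (𝓝 (D.toCover (γ 1) : D.Cover)) :=
    (((UniformSpace.Completion.continuous_coe D.Cover).comp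
      ((D.continuous_toCover hp).comp γ.continuous)).tendsto 1).mono_left nhdsWithin_le_nhds
  refine tendsto_nhds_unique h2 (h3.congr' ?_)
  filter_upwards [self_mem_nhdsWithin] with t ht
  have ht' : t < 1 := ht
  simp only [τ, dif_pos ht']

end DevelopmentPair

/-! ### Convexity -/

theorem mainTheorem2 {n d : ℕ} (hd : 0 < d) (hdn : d < n)
    {M : Type*} [TopologicalSpace M] [T2Space M] [CompactSpace M] [ConnectedSpace M]
    [ChartedSpace (AffModel n) M] [HasGroupoid M (affineGroupoid n)]
    {X : Type*} [TopologicalSpace X] [SimplyConnectedSpace X]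
    (p : X → M) (hp : IsCoveringMap p) (D : DevelopmentPair n p)
    (hsd : AffineShrinkableDimLE D.holonomyGroup d) :
    D.IsConvexOfDim d := by
  intro T s hT i hfaces
  have hdev := D.isLocalHomeomorph_dev hp
  have := hp.t2Space
  set ι := s.vertexChart i
  have hιc : Continuous ι := ι.continuous_of_finiteDimensional
  -- The exceptional side is where the coordinates sum to `1`; only its relative interior is left
  -- out.
  let Good : EuclideanSpace ℝ (Fin (d + 1)) → Prop := fun a =>
    a ∈ cornerSimplex (Fin (d + 1)) 1 ∧ (∑ k, a k < 1 ∨ ∃ k, a k = 0)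
  have hgood : ∀ a, ∃ x : X, Good a →
      ((D.toCover x : D.Cover) : D.Completion) ∈ T ∧ D.dev x = ι a := by
    intro a
    by_cases ha : Good a
    · obtain ⟨α, hαT, hα⟩ : ι a ∈ D.completionDev '' T := by
        rw [hT.image_eq]
        exact s.vertexChart_mem_closedInterior i ha.1
      have hαI : α ∉ D.idealSet := by
        by_cases hk : ∃ k, a k = 0
        · obtain ⟨k, hk⟩ := hk
          refine disjoint_left.1 (hfaces (i.succAbove k) (Fin.succAbove_ne i k)) ⟨hαT, ?_⟩
          rw [hα]
          exact s.vertexChart_mem_faceOpposite i ha.1 hk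
        · refine disjoint_left.1 hT.interior_disjoint ⟨hαT, ?_⟩
          rw [hα]
          push Not at hk
          exact s.vertexChart_mem_interior i (fun k => lt_of_le_of_ne (ha.1.1 k) (hk k).symm)
            (ha.2.resolve_right (by push Not; exact hk))
      obtain ⟨x, rfl⟩ := not_not.1 hαI
      refine ⟨D.ofCover x, fun _ => ⟨hαT, ?_⟩⟩
      rw [← hα, D.completionDev_coe]
    · exact ⟨Classical.arbitrary X, fun h => absurd h ha⟩
  choose ξ hξ using hgood
  -- The barycenter: all `d + 2` barycentric coordinates are equal.
  let b : EuclideanSpace ℝ (Fin (d + 1)) := WithLp.toLp 2 fun _ => 1 / ((d : ℝ) + 2)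
  have hb0 : ∀ k, 0 ≤ b k := fun k => by
    change (0 : ℝ) ≤ 1 / ((d : ℝ) + 2)
    positivity
  have hb1 : ∑ k, b k < 1 := by
    simp only [b, Finset.sum_const, Finset.card_univ, Fintype.card_fin, nsmul_eq_mul]
    push_cast
    rw [mul_one_div, div_lt_one (by positivity)]
    linarith
  have hbg : Good b := ⟨⟨hb0, hb1.le⟩, Or.inl hb1⟩
  have hline : ∀ a ∈ cornerSimplex (Fin (d + 1)) 1, ∀ t ∈ Ico (0 : ℝ) 1,
      Good (AffineMap.lineMap b a t) := by
    intro a ha t ht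
    refine ⟨(convex_cornerSimplex 1).lineMap_mem ⟨hb0, hb1.le⟩ ha ⟨ht.1, ht.2.le⟩, Or.inl ?_⟩
    have h1 : ∑ k, (AffineMap.lineMap b a t) k = (1 - t) * ∑ k, b k + t * ∑ k, a k := by
      simp only [AffineMap.lineMap_apply_module, PiLp.add_apply, PiLp.smul_apply, smul_eq_mul,
        Finset.sum_add_distrib, Finset.mul_sum]
    rw [h1]
    have h2 := mul_lt_mul_of_pos_left hb1 (sub_pos.2 ht.2)
    have h3 := mul_le_mul_of_nonneg_left ha.2 ht.1
    linarith
  set x₀ := ξ b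
  have hx₀ : D.dev x₀ = ι b := (hξ b hbg).2
  have hmap : ∀ a (t : ℝ), ι (AffineMap.lineMap b a t) = AffineMap.lineMap (D.dev x₀) (ι a) t := by
    intro a t
    rw [hx₀, AffineMap.apply_lineMap]
  have hlift : ∀ a, Good a → ι a ∈ starDomain D.dev x₀ ∧ starExp D.dev x₀ (ι a) = ξ a := by
    intro a ha
    have hg : ∀ t : I, Good (AffineMap.lineMap b a (t : ℝ)) := by
      intro t
      rcases t.2.2.lt_or_eq with h | h
      · exact hline a ha.1 t ⟨t.2.1, h⟩
      · rw [h, AffineMap.lineMap_apply_one]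
        exact ha
    -- Continuity of the path passes from its development to `T` by the embedding, then to the
    -- covering with its distance, which induces into the completion, and finally to `X`.
    let τ : I → T := fun t => ⟨_, (hξ _ (hg t)).1⟩
    have hτ : Continuous τ := by
      rw [hT.isEmbedding.continuous_iff]
      have : T.domRestrict D.completionDev ∘ τ =
          fun t : I => ι (AffineMap.lineMap b a (t : ℝ)) := by
        funext t
        simp only [Function.comp_apply, domRestrict_apply, τ]
        rw [D.completionDev_coe]
        exact (hξ _ (hg t)).2
      rw [this]
      exact hιc.comp (AffineMap.lineMap_continuous.comp continuous_subtype_val)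
    have hc : Continuous fun t : I => D.toCover (ξ (AffineMap.lineMap b a (t : ℝ))) := by
      rw [(UniformSpace.Completion.isUniformInducing_coe D.Cover).isInducing.continuous_iff]
      exact continuous_subtype_val.comp hτ
    let γ : C(I, X) := ⟨fun t => ξ (AffineMap.lineMap b a (t : ℝ)),
      (D.continuous_ofCover hp).comp hc⟩
    have h0 : γ 0 = x₀ := by
      change ξ (AffineMap.lineMap b a ((0 : I) : ℝ)) = ξ b
      simp
    have hγ : ∀ t : I, D.dev (γ t) = AffineMap.lineMap (D.dev x₀) (ι a) (t : ℝ) := fun t =>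
      ((hξ _ (hg t)).2).trans (hmap a t)
    refine ⟨⟨γ, h0, hγ⟩, ?_⟩
    rw [starExp_eq hdev h0 hγ]
    change ξ (AffineMap.lineMap b a ((1 : I) : ℝ)) = ξ a
    simp
  have hsub : cornerSimplex (Fin (d + 1)) 1 ⊆ ι ⁻¹' starDomain D.dev x₀ := by
    refine cornerSimplex_subset ((isOpen_starDomain hdev x₀).preimage hιc) hb0 hb1
      (fun a ha h => (hlift a ⟨ha, h⟩).1) fun x hx hbx => ?_
    exact D.not_eventually_segment_subset hp hsd (by simp) (s.vertexChart_injective i) hx₀ hbx hx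
  rw [disjoint_left]
  intro α hαT hαI
  obtain ⟨a, ha, hιa⟩ := s.exists_vertexChart_eq i (hT.image_eq ▸ mem_image_of_mem _ hαT)
  obtain ⟨γ, h0, hγ⟩ := hsub ha
  refine hαI ⟨D.toCover (γ 1), (D.coe_eq_of_lift hp hT.isEmbedding (fun t ht => ?_) hαT ?_).symm⟩
  · have hg := hline a ha t ⟨t.2.1, ht⟩
    have h1 := (lineMap_mem_starDomain_and_starExp_eq hdev h0 hγ t).2
    rw [← hmap, (hlift _ hg).2] at h1
    rw [← h1]
    exact (hξ _ hg).1
  · rw [hγ, ← hιa, Icc.coe_one, AffineMap.lineMap_apply_one]
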